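/- Let $n\ge 0$, $\alpha,\beta\in\mathbb C$, and consider the system for $n\times n$ matrices $$u'=-u^2+2uv+\alpha(uv-vu),\qquad v'=-v^2+2vu+\beta(vu-uv),$$ and its formal solutions $$u=\frac{p}{z-z_0}+x_0+x_1(z-z_0)+\cdots,\qquad v=\frac{q}{z-z_0}+y_0+y_1(z-z_0)+\cdots,\tag{y}$$ with $p,q,x_j,y_j\in \mathrm{Mat}_n(\mathbb C)$, $z_0\in\mathbb C$. Say that the formal solution with residues in the simultaneous conjugation orbit of a given pair $(p,q)$ *contains $N$ arbitrary constants* if there is a family of solutions (y), with residues in that orbit, whose point $z_0$ and coefficients are holomorphic functions of $c$ in a nonempty open subset of $\mathbb C^N$, such that no nonzero direction in $\mathbb C^N$ annihilates, at any point of this set, the differentials of $z_0$ and of all the coefficients. The formal solution is *maximal* if the largest such $N$ equals $2n^2$ ($z_0$ and $2n^2-1$ further constants). Let $\mathcal L$ be the operator on $\mathrm{Mat}_n(\mathbb C)\oplus\mathrm{Mat}_n(\mathbb C)$ $$\mathcal L\binom{X}{Y}=\binom{-pX-Xp+2(pY+Xq)+\alpha([p,Y]+[X,q])}{-qY-Yq+2(qX+Yp)+\beta([q,X]+[Y,p])}.$$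 Suppose that $[p,q]=0$ and that the formal solution with residues in the orbit of $(p,q)$ is maximal. Then, up to a simultaneous conjugation, $$p=\mathrm{diag}(-\mathbb I_{k_1},\mathbb I_{k_2},0_{k_3},0_{k_4}),\qquad q=\mathrm{diag}(-\mathbb I_{k_1},0_{k_2},\mathbb I_{k_3},0_{k_4}),\qquad k_1+k_2+k_3+k_4=n,$$ and for such $k_i$ one has $k_1^2+k_2^2+k_3^2=1$, and every eigenvalue of $\mathcal L$ other than $-1$ and $-2$ is a non-negative integer. More precisely, the eigenvalues of $\mathcal L$, counted with algebraic multiplicity, are $\lambda_1=-2$ taken $k_1^2+k_2^2+k_3^2$ times, $\lambda_3=-1$ taken $2(k_1k_2+k_1k_3+k_2k_3+k_1k_4+k_2k_4+k_3k_4)$ times, and otherwise non-negative integers. -/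

import Mathlib

open Matrix

namespace MatrixP4

/-- The homogeneous system `u' = -u² + 2uv + α(uv - vu)`, `v' = -v² + 2vu + β(vu - uv)`
for formal Laurent series, in the variable `t = z - z₀`, with matrix coefficients. -/
def IsFormalSolution {n : ℕ} (α β : ℂ) (u v : LaurentSeries (Matrix (Fin n) (Fin n) ℂ)) : Prop :=
  LaurentSeries.derivative ℂ u = -(u * u) + (2 : ℂ) • (u * v) + α • (u * v - v * u) ∧
  LaurentSeries.derivative ℂ v = -(v * v) + (2 : ℂ) • (v * u) + β • (v * u - u * v)

/-- The series has the form `p / t + x₀ + x₁ t + ⋯`. -/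
def HasSimplePolarPart {n : ℕ} (u : LaurentSeries (Matrix (Fin n) (Fin n) ℂ)) : Prop :=
  ∀ m : ℤ, m < -1 → u.coeff m = 0

/-- The coefficient of `t⁻¹`. -/
def residue {n : ℕ} (u : LaurentSeries (Matrix (Fin n) (Fin n) ℂ)) : Matrix (Fin n) (Fin n) ℂ :=
  u.coeff (-1)

/-- `(p, q)` and `(p', q')` lie in the same orbit of simultaneous conjugation. -/
def SameOrbit {n : ℕ} (p q p' q' : Matrix (Fin n) (Fin n) ℂ) : Prop :=
  ∃ S : GL (Fin n) ℂ,
    p' = (S : Matrix (Fin n) (Fin n) ℂ) * p * ((S⁻¹ : GL (Fin n) ℂ) : Matrix (Fin n) (Fin n) ℂ) ∧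
    q' = (S : Matrix (Fin n) (Fin n) ℂ) * q * ((S⁻¹ : GL (Fin n) ℂ) : Matrix (Fin n) (Fin n) ℂ)

/-- A formal solution `u = ∑ xⱼ(c) (z - z₀(c))ʲ`, `v = ∑ yⱼ(c) (z - z₀(c))ʲ`, `j ≥ -1`, that contains
`N` arbitrary constants `c = (c₁, …, c_N)`, with residues in the conjugation orbit of `(p, q)`.
The constants range over a nonempty open set `U`, the point `z₀` and all coefficients depend
holomorphically on them, and the constants are independent: no nonzero infinitesimal change of `c`
leaves `z₀` and all the coefficients unchanged to first order. -/
structure FormalSolutionFamily {n : ℕ} (α β : ℂ) (p q : Matrix (Fin n) (Fin n) ℂ) (N : ℕ) where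
  U : Set (Fin N → ℂ)
  isOpen_U : IsOpen U
  nonempty_U : U.Nonempty
  z₀ : (Fin N → ℂ) → ℂ
  u : (Fin N → ℂ) → LaurentSeries (Matrix (Fin n) (Fin n) ℂ)
  v : (Fin N → ℂ) → LaurentSeries (Matrix (Fin n) (Fin n) ℂ)
  polar_u : ∀ c ∈ U, HasSimplePolarPart (u c)
  polar_v : ∀ c ∈ U, HasSimplePolarPart (v c)
  solution : ∀ c ∈ U, IsFormalSolution α β (u c) (v c)
  orbit : ∀ c ∈ U, SameOrbit p q (residue (u c)) (residue (v c))
  holo_z₀ : DifferentiableOn ℂ z₀ U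
  holo_u : ∀ (m : ℤ) (i j : Fin n), DifferentiableOn ℂ (fun c => (u c).coeff m i j) U
  holo_v : ∀ (m : ℤ) (i j : Fin n), DifferentiableOn ℂ (fun c => (v c).coeff m i j) U
  independent : ∀ c ∈ U, ∀ w : Fin N → ℂ,
    fderiv ℂ z₀ c w = 0 →
    (∀ (m : ℤ) (i j : Fin n), fderiv ℂ (fun c => (u c).coeff m i j) c w = 0) →
    (∀ (m : ℤ) (i j : Fin n), fderiv ℂ (fun c => (v c).coeff m i j) c w = 0) →
    w = 0

/-- The formal solution with residues in the orbit of `(p, q)` is maximal: the number of arbitrary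
constants that it contains is exactly `2n²`, that is, `z₀` and `2n² - 1` further constants in the
residues and the coefficients. -/
def IsMaximal {n : ℕ} (α β : ℂ) (p q : Matrix (Fin n) (Fin n) ℂ) : Prop :=
  IsGreatest {N : ℕ | Nonempty (FormalSolutionFamily α β p q N)} (2 * n ^ 2)

/-- The operator `𝓛` of the recurrence relations for the coefficients of the formal solution. -/
def opL {n : ℕ} (α β : ℂ) (p q : Matrix (Fin n) (Fin n) ℂ) :
    Module.End ℂ (Matrix (Fin n) (Fin n) ℂ × Matrix (Fin n) (Fin n) ℂ) where
  toFun Z :=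
    (-(p * Z.1) - Z.1 * p + (2 : ℂ) • (p * Z.2 + Z.1 * q)
        + α • ((p * Z.2 - Z.2 * p) + (Z.1 * q - q * Z.1)),
      -(q * Z.2) - Z.2 * q + (2 : ℂ) • (q * Z.1 + Z.2 * p)
        + β • ((q * Z.1 - Z.1 * q) + (Z.2 * p - p * Z.2)))
  map_add' A B := by
    ext1 <;> simp only [Prod.fst_add, Prod.snd_add, mul_add, add_mul] <;> module
  map_smul' r A := by
    ext1 <;> simp only [Prod.smul_fst, Prod.smul_snd, Matrix.mul_smul, Matrix.smul_mul,
      RingHom.id_apply] <;> module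

/-- `diag(-I_{k₁}, I_{k₂}, 0_{k₃}, 0_{k₄})` -/
def canonicalP (k₁ k₂ k₃ k₄ : ℕ) :
    Matrix (Fin k₁ ⊕ Fin k₂ ⊕ Fin k₃ ⊕ Fin k₄) (Fin k₁ ⊕ Fin k₂ ⊕ Fin k₃ ⊕ Fin k₄) ℂ :=
  Matrix.diagonal
    (Sum.elim (fun _ => -1) (Sum.elim (fun _ => 1) (Sum.elim (fun _ => 0) (fun _ => 0))))

/-- `diag(-I_{k₁}, 0_{k₂}, I_{k₃}, 0_{k₄})` -/
def canonicalQ (k₁ k₂ k₃ k₄ : ℕ) :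
    Matrix (Fin k₁ ⊕ Fin k₂ ⊕ Fin k₃ ⊕ Fin k₄) (Fin k₁ ⊕ Fin k₂ ⊕ Fin k₃ ⊕ Fin k₄) ℂ :=
  Matrix.diagonal
    (Sum.elim (fun _ => -1) (Sum.elim (fun _ => 0) (Sum.elim (fun _ => 1) (fun _ => 0))))

/-- Up to a simultaneous conjugation, `p = diag(-I_{k₁}, I_{k₂}, 0_{k₃}, 0_{k₄})` and
`q = diag(-I_{k₁}, 0_{k₂}, I_{k₃}, 0_{k₄})`. The bijection `e` forces `k₁ + k₂ + k₃ + k₄ = n`. -/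
def HasCanonicalForm {n : ℕ} (p q : Matrix (Fin n) (Fin n) ℂ) (k₁ k₂ k₃ k₄ : ℕ) : Prop :=
  ∃ e : Fin n ≃ Fin k₁ ⊕ Fin k₂ ⊕ Fin k₃ ⊕ Fin k₄,
    SameOrbit ((canonicalP k₁ k₂ k₃ k₄).submatrix e e) ((canonicalQ k₁ k₂ k₃ k₄).submatrix e e) p q

end MatrixP4

/-! The coefficients obey a recurrence whose linear part at the coefficient of `t ^ (k - 1)` is `𝓛 -
(k - 1)`. For commuting residues the lowest equations read `p² = p + 2pq`, `q² = q + 2pq`; they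
split the space into joint eigenspaces with four possible pairs of eigenvalues
(`exists_hasCanonicalForm`). In a basis adapted to this splitting `𝓛` acts on each matrix entry by a
2×2 block. One eigenvalue, `eig₁`, is `-2`, `-1` or `0`; the other, `eig₂`, may depend on `α` and
`β`.

Differentiate a family along a direction that fixes `z₀`. The first nonzero derivative of the
coefficients is an eigenvector of `𝓛` with eigenvalue `k - 1` (`opL_derivative`), and for `k = 0` it
also satisfies the linearized relation `[p, q] = 0`. So an entry supplies at most two constants. It
loses one if `eig₁ = -2`, and one if `eig₂` is not a natural number (`maxConstants_add`). With one
more constant for `z₀`, `card_le` gives `N ≤ 1 + 2n² - K - B`, where `K = k₁² + k₂² + k₃²` and `B`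
counts the entries with a bad `eig₂`.

If `N = 2n²`, then `K + B ≤ 1`. The case `K = 0` means `p = q = 0`, where the solutions without pole
have `2n² + 1` constants (`nonempty_regular_family`), against maximality. Hence `K = 1` and `B = 0`,
and the spectrum is read off from the blocks. -/

namespace MatrixP4

variable {n : ℕ}

/-! ### Coefficient recurrences of a formal solution -/

/-- The bilinear expression whose diagonal is the right-hand side of the first equation. The second
equation has the same form with the unknowns exchanged. -/
def quad (α : ℂ) (x y x' y' : Matrix (Fin n) (Fin n) ℂ) : Matrix (Fin n) (Fin n) ℂ :=
  -(x * x') + (2 : ℂ) • (x * y') + α • (x * y' - y * x')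

theorem coeff_mul_of_lt {u v : LaurentSeries (Matrix (Fin n) (Fin n) ℂ)}
    (hu : HasSimplePolarPart u) (hv : HasSimplePolarPart v) {m : ℤ} (hm : m < -2) :
    (u * v).coeff m = 0 := by
  rw [HahnSeries.coeff_mul]
  refine Finset.sum_eq_zero fun ij hij => ?_
  rw [Finset.mem_antidiagonal] at hij
  rcases lt_or_ge ij.1 (-1) with h | h
  · rw [hu _ h, zero_mul]
  · rw [hv ij.2 (by omega), mul_zero]

theorem coeff_mul_eq_sum {u v : LaurentSeries (Matrix (Fin n) (Fin n) ℂ)}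
    (hu : HasSimplePolarPart u) (hv : HasSimplePolarPart v) (k : ℕ) :
    (u * v).coeff ((k : ℤ) - 2) =
      ∑ ij ∈ Finset.HasAntidiagonal.antidiagonal k, u.coeff ((ij.1 : ℤ) - 1) * v.coeff ((ij.2 : ℤ) - 1) := by
  rw [HahnSeries.coeff_mul]
  -- The Hahn series sum runs over the supports only, so the two index sets match just on nonzero
  -- terms, after a shift by one in each index.
  refine Finset.sum_bij_ne_zero (fun ij _ _ => ((ij.1 + 1).toNat, (ij.2 + 1).toNat))
    ?_ ?_ ?_ ?_
  · intro ij hij h0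
    rw [Finset.mem_antidiagonal] at hij
    have h1 : ¬ ij.1 < -1 := fun h => h0 (by rw [hu _ h, zero_mul])
    have h2 : ¬ ij.2 < -1 := fun h => h0 (by rw [hv _ h, mul_zero])
    rw [Finset.HasAntidiagonal.mem_antidiagonal]
    dsimp only
    omega
  · intro ij _ h0 ij' _ h0' h
    have h1 : ¬ ij.1 < -1 := fun h => h0 (by rw [hu _ h, zero_mul])
    have h2 : ¬ ij.2 < -1 := fun h => h0 (by rw [hv _ h, mul_zero])
    have h1' : ¬ ij'.1 < -1 := fun h => h0' (by rw [hu _ h, zero_mul])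
    have h2' : ¬ ij'.2 < -1 := fun h => h0' (by rw [hv _ h, mul_zero])
    rw [Prod.mk.injEq] at h
    ext <;> omega
  · intro ij hij h0
    rw [Finset.HasAntidiagonal.mem_antidiagonal] at hij
    refine ⟨((ij.1 : ℤ) - 1, (ij.2 : ℤ) - 1), ?_, h0, by ext <;> simp⟩
    rw [Finset.mem_antidiagonal]
    refine ⟨fun h => h0 ?_, fun h => h0 ?_, ?_⟩
    · rw [h, zero_mul]
    · rw [h, mul_zero]
    · dsimp only
      omega
  · intro ij hij h0
    have h1 : ¬ ij.1 < -1 := fun h => h0 (by rw [hu _ h, zero_mul])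
    have h2 : ¬ ij.2 < -1 := fun h => h0 (by rw [hv _ h, mul_zero])
    dsimp only
    congr 2 <;> omega

theorem derivative_coeff (u : LaurentSeries (Matrix (Fin n) (Fin n) ℂ)) (m : ℤ) :
    (LaurentSeries.derivative ℂ u).coeff m = ((m : ℂ) + 1) • u.coeff (m + 1) := by
  rw [LaurentSeries.derivative, LaurentSeries.hasseDeriv_coeff, Nat.cast_one,
    Ring.choose_one_right, ← Int.cast_smul_eq_zsmul ℂ]
  push_cast
  rfl

/-- Comparison of the coefficients of `t ^ (k - 2)`; lower powers vanish on both sides. Exchanging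
`u` and `v` gives the second equation of the system. -/
theorem equation_iff {α : ℂ} {u v : LaurentSeries (Matrix (Fin n) (Fin n) ℂ)}
    (hu : HasSimplePolarPart u) (hv : HasSimplePolarPart v) :
    LaurentSeries.derivative ℂ u = -(u * u) + (2 : ℂ) • (u * v) + α • (u * v - v * u) ↔
      ∀ k : ℕ, ((k : ℂ) - 1) • u.coeff ((k : ℤ) - 1) =
        ∑ ij ∈ Finset.HasAntidiagonal.antidiagonal k, quad α (u.coeff ((ij.1 : ℤ) - 1)) (v.coeff ((ij.1 : ℤ) - 1))
          (u.coeff ((ij.2 : ℤ) - 1)) (v.coeff ((ij.2 : ℤ) - 1)) := by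
  have key : ∀ k : ℕ,
      (-(u * u) + (2 : ℂ) • (u * v) + α • (u * v - v * u)).coeff ((k : ℤ) - 2) =
        ∑ ij ∈ Finset.HasAntidiagonal.antidiagonal k, quad α (u.coeff ((ij.1 : ℤ) - 1)) (v.coeff ((ij.1 : ℤ) - 1))
          (u.coeff ((ij.2 : ℤ) - 1)) (v.coeff ((ij.2 : ℤ) - 1)) := by
    intro k
    simp only [HahnSeries.coeff_add, HahnSeries.coeff_neg, HahnSeries.coeff_smul,
      HahnSeries.coeff_sub, coeff_mul_eq_sum hu hu, coeff_mul_eq_sum hu hv, coeff_mul_eq_sum hv hu,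
      quad, Finset.sum_add_distrib, Finset.sum_neg_distrib, Finset.smul_sum,
      Finset.sum_sub_distrib, smul_sub]
  have key' : ∀ k : ℕ, (LaurentSeries.derivative ℂ u).coeff ((k : ℤ) - 2) =
      ((k : ℂ) - 1) • u.coeff ((k : ℤ) - 1) := by
    intro k
    rw [derivative_coeff, show (k : ℤ) - 2 + 1 = k - 1 by ring]
    push_cast
    ring_nf
  constructor
  · intro h k
    rw [← key, ← key', h]
  · intro h
    ext1
    funext m
    rcases lt_or_ge m (-2) with hm | hm
    · rw [derivative_coeff, hu _ (by omega)]
      simp [coeff_mul_of_lt hu hu hm, coeff_mul_of_lt hu hv hm, coeff_mul_of_lt hv hu hm]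
    · obtain ⟨k, rfl⟩ : ∃ k : ℕ, m = (k : ℤ) - 2 := ⟨(m + 2).toNat, by omega⟩
      rw [key, key', h]

/-! ### Joint eigenspaces of commuting residues -/

/-- The eigenvalue of `p` on the `i`-th joint eigenspace. -/
def pVal : Fin 4 → ℂ := ![-1, 1, 0, 0]

/-- The eigenvalue of `q` on the `i`-th joint eigenspace. -/
def qVal : Fin 4 → ℂ := ![-1, 0, 1, 0]

/-- The block to which an index of the canonical form belongs. -/
def blockIndex {k₁ k₂ k₃ k₄ : ℕ} : Fin k₁ ⊕ Fin k₂ ⊕ Fin k₃ ⊕ Fin k₄ → Fin 4 :=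
  Sum.elim (fun _ => 0) (Sum.elim (fun _ => 1) (Sum.elim (fun _ => 2) (fun _ => 3)))

theorem canonicalP_submatrix {k₁ k₂ k₃ k₄ : ℕ} (e : Fin n ≃ Fin k₁ ⊕ Fin k₂ ⊕ Fin k₃ ⊕ Fin k₄) :
    (canonicalP k₁ k₂ k₃ k₄).submatrix e e = diagonal fun a => pVal (blockIndex (e a)) := by
  rw [canonicalP, submatrix_diagonal_equiv]
  congr 1
  funext a
  simp only [Function.comp_apply]
  rcases e a with x | x | x | x <;> simp [blockIndex, pVal]

theorem canonicalQ_submatrix {k₁ k₂ k₃ k₄ : ℕ} (e : Fin n ≃ Fin k₁ ⊕ Fin k₂ ⊕ Fin k₃ ⊕ Fin k₄) :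
    (canonicalQ k₁ k₂ k₃ k₄).submatrix e e = diagonal fun a => qVal (blockIndex (e a)) := by
  rw [canonicalQ, submatrix_diagonal_equiv]
  congr 1
  funext a
  simp only [Function.comp_apply]
  rcases e a with x | x | x | x <;> simp [blockIndex, qVal]

theorem sum_blockIndex {M : Type*} [AddCommMonoid M] {k₁ k₂ k₃ k₄ : ℕ}
    (e : Fin n ≃ Fin k₁ ⊕ Fin k₂ ⊕ Fin k₃ ⊕ Fin k₄) (f : Fin 4 → M) :
    ∑ a, f (blockIndex (e a)) = k₁ • f 0 + (k₂ • f 1 + (k₃ • f 2 + k₄ • f 3)) := by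
  rw [Equiv.sum_comp e fun x => f (blockIndex x)]
  simp [Fintype.sum_sum_type, blockIndex]

theorem sameOrbit_of_basis {p q : Matrix (Fin n) (Fin n) ℂ} {d d' : Fin n → ℂ}
    (b : Module.Basis (Fin n) ℂ (Fin n → ℂ)) (hp : ∀ a, p *ᵥ b a = d a • b a)
    (hq : ∀ a, q *ᵥ b a = d' a • b a) : SameOrbit (diagonal d) (diagonal d') p q := by
  have hinv : IsUnit ((Pi.basisFun ℂ (Fin n)).toMatrix b) :=
    @isUnit_of_invertible _ _ _ ((Pi.basisFun ℂ (Fin n)).invertibleToMatrix b)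
  obtain ⟨S, hS⟩ := hinv
  have key : ∀ (r : Matrix (Fin n) (Fin n) ℂ) (c : Fin n → ℂ), (∀ a, r *ᵥ b a = c a • b a) →
      r = (S : Matrix (Fin n) (Fin n) ℂ) * diagonal c *
        ((S⁻¹ : GL (Fin n) ℂ) : Matrix (Fin n) (Fin n) ℂ) := by
    intro r c h
    rw [Units.eq_mul_inv_iff_mul_eq, hS]
    ext i j
    have := congrFun (h j) i
    rw [mul_diagonal, Module.Basis.toMatrix_apply, Pi.basisFun_repr, mul_comm]
    simpa [mul_apply, mulVec, dotProduct, Module.Basis.toMatrix_apply] using this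
  exact ⟨S, key p d hp, key q d' hq⟩

/-- Commuting matrices that satisfy the equations for the residues are simultaneously
diagonalizable with four possible pairs of eigenvalues. -/
theorem exists_hasCanonicalForm {p q : Matrix (Fin n) (Fin n) ℂ} (hcomm : p * q = q * p)
    (hp : p * p = p + (2 : ℂ) • (p * q)) (hq : q * q = q + (2 : ℂ) • (p * q)) :
    ∃ k₁ k₂ k₃ k₄ : ℕ, HasCanonicalForm p q k₁ k₂ k₃ k₄ := by
  have h1 : p * p * q = p * q + (2 : ℂ) • (p * q * q) := by
    rw [hp, add_mul, smul_mul_assoc]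
  have h2 : p * (q * q) = p * q + (2 : ℂ) • (p * p * q) := by
    rw [hq, mul_add, mul_smul_comm, mul_assoc]
  -- `h1` and `h2` are linear in `p²q` and `pq²`; eliminating one of them leaves `3pq² = -3pq`.
  have hpqq : p * (p * q) = -(p * q) ∧ p * (q * q) = -(p * q) := by
    rw [← mul_assoc, h1, mul_assoc, h2, h1, mul_assoc]
    have h3 : p * (q * q) = p * q + (2 : ℂ) • (p * q + (2 : ℂ) • (p * (q * q))) := by
      rw [← mul_assoc p q q, ← h1]; rw [mul_assoc p q q]; exact h2
    have h4 : (3 : ℂ) • (p * (q * q)) = (3 : ℂ) • (-(p * q)) := by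
      linear_combination (norm := module) (-1 : ℂ) • h3
    have h5 : p * (q * q) = -(p * q) := smul_right_injective _ (by norm_num : (3 : ℂ) ≠ 0) h4
    rw [h5]
    constructor <;> module
  obtain ⟨hppq, hpqq⟩ := hpqq
  have hqpq : q * (p * q) = -(p * q) := by rw [← mul_assoc, ← hcomm, mul_assoc, hpqq]
  have hqp : q * p = p * q := hcomm.symm
  let P := toLin' p
  let Q := toLin' q
  let A : Fin 4 → Submodule ℂ (Fin n → ℂ) :=
    fun i => Module.End.eigenspace P (pVal i) ⊓ Module.End.eigenspace Q (qVal i)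
  have hA : ∀ i v, v ∈ A i ↔ p *ᵥ v = pVal i • v ∧ q *ᵥ v = qVal i • v := by
    intro i v
    rw [Submodule.mem_inf, Module.End.mem_eigenspace_iff, Module.End.mem_eigenspace_iff]
    rfl
  have hmem : ∀ (i : Fin 4) (E : Matrix (Fin n) (Fin n) ℂ), p * E = pVal i • E →
      q * E = qVal i • E → ∀ v, E *ᵥ v ∈ A i := by
    intro i E h h' v
    rw [hA, mulVec_mulVec, mulVec_mulVec, h, h', smul_mulVec, smul_mulVec]
    exact ⟨rfl, rfl⟩
  have hint : DirectSum.IsInternal A := by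
    rw [DirectSum.isInternal_submodule_iff_iSupIndep_and_iSup_eq_top]
    constructor
    -- The combination `p + 2q` takes the distinct values `-3, 1, 2, 0` on the four pairs, so
    -- independence follows from that of the eigenspaces of a single operator.
    · have hinj : Function.Injective fun i : Fin 4 => pVal i + 2 * qVal i := by
        intro i j h
        fin_cases i <;> fin_cases j <;> first | rfl | (norm_num [pVal, qVal] at h)
      refine ((Module.End.eigenspaces_iSupIndep (P + (2 : ℂ) • Q)).comp hinj).mono ?_
      intro i v hv
      rw [Submodule.mem_inf, Module.End.mem_eigenspace_iff, Module.End.mem_eigenspace_iff] at hv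
      rw [Function.comp_apply, Module.End.mem_eigenspace_iff, LinearMap.add_apply,
        LinearMap.smul_apply, hv.1, hv.2]
      module
    · rw [eq_top_iff]
      intro v _
      -- The four summands are the images of `v` under the projections onto the joint eigenspaces,
      -- which add up to the identity.
      have hv : v = (p * q) *ᵥ v + (p + p * q) *ᵥ v + (q + p * q) *ᵥ v +
          (1 - p - q - (3 : ℂ) • (p * q)) *ᵥ v := by
        rw [← add_mulVec, ← add_mulVec, ← add_mulVec]
        have : p * q + (p + p * q) + (q + p * q) + (1 - p - q - (3 : ℂ) • (p * q)) = 1 := by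
          module
        rw [this, one_mulVec]
      rw [hv]
      refine add_mem (add_mem (add_mem ?_ ?_) ?_) ?_
      · refine Submodule.mem_iSup_of_mem 0 (hmem 0 _ ?_ ?_ v)
        · rw [hppq]; simp [pVal]
        · rw [hqpq]; simp [qVal]
      · refine Submodule.mem_iSup_of_mem 1 (hmem 1 _ ?_ ?_ v)
        · rw [mul_add, hppq, hp]; simp only [pVal, cons_val]; module
        · rw [mul_add, hqpq, hqp]; simp [qVal]
      · refine Submodule.mem_iSup_of_mem 2 (hmem 2 _ ?_ ?_ v)
        · rw [mul_add, hppq]; simp [pVal]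
        · rw [mul_add, hqpq, hq]; simp only [qVal, cons_val]; module
      · refine Submodule.mem_iSup_of_mem 3 (hmem 3 _ ?_ ?_ v)
        · rw [mul_sub, mul_sub, mul_sub, mul_smul_comm, hppq, hp, mul_one]
          simp only [pVal, cons_val]; module
        · rw [mul_sub, mul_sub, mul_sub, mul_smul_comm, hqpq, hq, mul_one, hqp]
          simp only [qVal, cons_val]; module
  let k : Fin 4 → ℕ := fun i => Module.finrank ℂ (A i)
  let b := hint.collectedBasis fun i => Module.finBasis ℂ (A i)
  let g : Fin (k 0) ⊕ Fin (k 1) ⊕ Fin (k 2) ⊕ Fin (k 3) → Σ i, Fin (k i) :=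
    Sum.elim (fun x => ⟨0, x⟩) (Sum.elim (fun x => ⟨1, x⟩) (Sum.elim (fun x => ⟨2, x⟩)
      (fun x => ⟨3, x⟩)))
  have hg : Function.Bijective g := by
    constructor
    · rintro (x | x | x | x) (y | y | y | y) h <;> simp [g] at h <;> simp [h]
    · rintro ⟨i, x⟩
      fin_cases i
      exacts [⟨.inl x, rfl⟩, ⟨.inr (.inl x), rfl⟩, ⟨.inr (.inr (.inl x)), rfl⟩,
        ⟨.inr (.inr (.inr x)), rfl⟩]
  have hgi : ∀ x, (g x).1 = blockIndex x := by
    rintro (x | x | x | x) <;> rfl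
  let b' := b.reindex (Equiv.ofBijective g hg).symm
  have hcard : Fintype.card (Fin n) =
      Fintype.card (Fin (k 0) ⊕ Fin (k 1) ⊕ Fin (k 2) ⊕ Fin (k 3)) := by
    rw [← Module.finrank_eq_card_basis b', Module.finrank_fin_fun, Fintype.card_fin]
  let e := Fintype.equivOfCardEq hcard
  have hb : ∀ a, (b'.reindex e.symm) a ∈ A (blockIndex (e a)) := by
    intro a
    rw [Module.Basis.reindex_apply, Module.Basis.reindex_apply, Equiv.symm_symm, Equiv.symm_symm,
      Equiv.ofBijective_apply, ← hgi]
    exact hint.collectedBasis_mem _ _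
  refine ⟨k 0, k 1, k 2, k 3, e, ?_⟩
  rw [canonicalP_submatrix, canonicalQ_submatrix]
  exact sameOrbit_of_basis (b'.reindex e.symm) (fun a => ((hA _ _).1 (hb a)).1)
    fun a => ((hA _ _).1 (hb a)).2

/-! ### Spectrum of `𝓛` by 2×2 blocks -/

theorem SameOrbit.exists_algEquiv {p q p' q' : Matrix (Fin n) (Fin n) ℂ}
    (h : SameOrbit p q p' q') :
    ∃ φ : Matrix (Fin n) (Fin n) ℂ ≃ₐ[ℂ] Matrix (Fin n) (Fin n) ℂ, φ p = p' ∧ φ q = q' := by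
  obtain ⟨S, rfl, rfl⟩ := h
  exact ⟨MulSemiringAction.toAlgEquiv ℂ (Matrix (Fin n) (Fin n) ℂ) (ConjAct.toConjAct S), rfl, rfl⟩

theorem opL_map (α β : ℂ) (φ : Matrix (Fin n) (Fin n) ℂ ≃ₐ[ℂ] Matrix (Fin n) (Fin n) ℂ)
    (p q X Y : Matrix (Fin n) (Fin n) ℂ) :
    opL α β (φ p) (φ q) (φ X, φ Y) = Prod.map φ φ (opL α β p q (X, Y)) := by
  simp [opL]

theorem SameOrbit.charpoly_opL {p q p' q' : Matrix (Fin n) (Fin n) ℂ} (α β : ℂ)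
    (h : SameOrbit p q p' q') : (opL α β p' q').charpoly = (opL α β p q).charpoly := by
  obtain ⟨φ, rfl, rfl⟩ := h.exists_algEquiv
  rw [← LinearEquiv.charpoly_conj (φ.toLinearEquiv.prodCongr φ.toLinearEquiv) (opL α β p q)]
  congr 1
  refine LinearMap.ext fun Z => ?_
  rw [LinearEquiv.conj_apply_apply]
  obtain ⟨X, Y⟩ := Z
  have := opL_map α β φ p q (φ.symm X) (φ.symm Y)
  rw [φ.apply_symm_apply, φ.apply_symm_apply] at this
  exact this

/-- The action of `𝓛` on the entries in the block `(i, j)`. -/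
def blockL (α β : ℂ) (i j : Fin 4) : Matrix (Fin 2) (Fin 2) ℂ :=
  !![-(pVal i + pVal j) + 2 * qVal j + α * (qVal j - qVal i),
      2 * pVal i + α * (pVal i - pVal j);
    2 * qVal i + β * (qVal i - qVal j),
      -(qVal i + qVal j) + 2 * pVal j + β * (pVal j - pVal i)]

/-- The eigenvalue of `blockL` that does not depend on `α` and `β`. -/
def eig₁ (i j : Fin 4) : ℂ := if i = j then if i = 3 then 0 else -2 else -1

/-- The other eigenvalue of `blockL`. -/
def eig₂ (α β : ℂ) (i j : Fin 4) : ℂ := (blockL α β i j).trace - eig₁ i j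

theorem blockL_trace (α β : ℂ) (i j : Fin 4) :
    (blockL α β i j).trace = eig₁ i j + eig₂ α β i j := by
  rw [eig₂]; ring

/-- Since `eig₂` is defined through the trace, this is the real check that `eig₁` is an eigenvalue.
Conceptually, `-2` comes from a shift of `z₀`, with eigenvector `(p, q)`, and `-1` from
infinitesimal conjugation of the residues. -/
theorem blockL_det (α β : ℂ) (i j : Fin 4) :
    (blockL α β i j).det = eig₁ i j * eig₂ α β i j := by
  rw [eig₂, trace_fin_two, det_fin_two]
  fin_cases i <;> fin_cases j <;> simp [blockL, eig₁, pVal, qVal] <;> ring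

theorem eig₂_self {α β : ℂ} {i : Fin 4} (hi : i ≠ 3) : eig₂ α β i i = 2 := by
  rw [eig₂, trace_fin_two]
  fin_cases i <;> simp [blockL, eig₁, pVal, qVal] at hi ⊢ <;> norm_num

theorem eig₂_three {α β : ℂ} : eig₂ α β 3 3 = 0 := by
  rw [eig₂, trace_fin_two]
  simp [blockL, eig₁, pVal, qVal]

theorem blockL_charpoly (α β : ℂ) (i j : Fin 4) : (blockL α β i j).charpoly =
    (Polynomial.X - Polynomial.C (eig₁ i j)) * (Polynomial.X - Polynomial.C (eig₂ α β i j)) := by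
  rw [charpoly_fin_two, blockL_trace, blockL_det, Polynomial.C_mul, Polynomial.C_add]
  ring

theorem charpoly_blockDiagonal {R m o : Type*} [CommRing R] [Fintype m] [DecidableEq m]
    [Fintype o] [DecidableEq o] (M : o → Matrix m m R) :
    (blockDiagonal M).charpoly = ∏ k, (M k).charpoly := by
  simp only [charpoly]
  rw [← det_blockDiagonal]
  congr 1
  ext1 ⟨i, k⟩ ⟨j, l⟩
  by_cases hkl : k = l
  · subst hkl
    by_cases hij : i = j
    · subst hij
      simp [blockDiagonal_apply]
    · simp [blockDiagonal_apply, hij]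
  · simp [blockDiagonal_apply, hkl]

/-- A pair of matrices as a vector of its entries. -/
def entries : (Matrix (Fin n) (Fin n) ℂ × Matrix (Fin n) (Fin n) ℂ) ≃ₗ[ℂ]
    (Fin 2 × (Fin n × Fin n) → ℂ) where
  toFun Z x := ![Z.1 x.2.1 x.2.2, Z.2 x.2.1 x.2.2] x.1
  invFun v := (of fun a b => v (0, (a, b)), of fun a b => v (1, (a, b)))
  map_add' Z Z' := by
    funext ⟨i, a, b⟩
    fin_cases i <;> simp
  map_smul' r Z := by
    funext ⟨i, a, b⟩
    fin_cases i <;> simp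
  left_inv Z := rfl
  right_inv v := by
    funext ⟨i, a, b⟩
    fin_cases i <;> simp

theorem opL_diagonal_entry (α β : ℂ) (τ : Fin n → Fin 4)
    (Z : Matrix (Fin n) (Fin n) ℂ × Matrix (Fin n) (Fin n) ℂ) (a b : Fin n) :
    ![(opL α β (diagonal fun a => pVal (τ a)) (diagonal fun a => qVal (τ a)) Z).1 a b,
      (opL α β (diagonal fun a => pVal (τ a)) (diagonal fun a => qVal (τ a)) Z).2 a b] =
      blockL α β (τ a) (τ b) *ᵥ ![Z.1 a b, Z.2 a b] := by
  funext i
  fin_cases i <;>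
    simp [opL, blockL, mulVec, dotProduct, Fin.sum_univ_two, diagonal_mul, mul_diagonal] <;> ring

/-- For diagonal residues `𝓛` does not mix different matrix positions, so in the coordinates
`entries` it is block diagonal. -/
theorem charpoly_opL_diagonal (α β : ℂ) (τ : Fin n → Fin 4) :
    (opL α β (diagonal fun a => pVal (τ a)) (diagonal fun a => qVal (τ a))).charpoly =
      ∏ x : Fin n × Fin n, (blockL α β (τ x.1) (τ x.2)).charpoly := by
  rw [← charpoly_blockDiagonal, ← charpoly_toLin', ← LinearEquiv.charpoly_conj entries]
  congr 1
  refine LinearMap.ext fun v => ?_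
  obtain ⟨Z, rfl⟩ := entries.surjective v
  rw [LinearEquiv.conj_apply_apply, LinearEquiv.symm_apply_apply, toLin'_apply]
  funext ⟨i, a, b⟩
  refine (congrFun (opL_diagonal_entry α β τ Z a b) i).trans ?_
  simp only [mulVec, dotProduct, Fintype.sum_prod_type, blockDiagonal_apply]
  refine Finset.sum_congr rfl fun j _ => ?_
  rw [Finset.sum_eq_single a, Finset.sum_eq_single b]
  · rw [if_pos rfl]
    rfl
  · intro c _ hc
    rw [if_neg (by simp [hc.symm]), zero_mul]
  · simp
  · intro c _ hc
    refine Finset.sum_eq_zero fun d _ => ?_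
    rw [if_neg (by simp [hc.symm]), zero_mul]
  · simp

theorem roots_charpoly_opL {α β : ℂ} {p q : Matrix (Fin n) (Fin n) ℂ} {τ : Fin n → Fin 4}
    (h : SameOrbit (diagonal fun a => pVal (τ a)) (diagonal fun a => qVal (τ a)) p q) :
    (opL α β p q).charpoly.roots =
      ∑ x : Fin n × Fin n, ({eig₁ (τ x.1) (τ x.2)} + {eig₂ α β (τ x.1) (τ x.2)}) := by
  rw [h.charpoly_opL, charpoly_opL_diagonal, Polynomial.roots_prod _ _
    (Finset.prod_ne_zero_iff.2 fun x _ => (charpoly_monic _).ne_zero)]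
  change (∑ x : Fin n × Fin n, _) = _
  refine Finset.sum_congr rfl fun x _ => ?_
  rw [blockL_charpoly, Polynomial.roots_mul (mul_ne_zero (Polynomial.X_sub_C_ne_zero _)
    (Polynomial.X_sub_C_ne_zero _)), Polynomial.roots_X_sub_C, Polynomial.roots_X_sub_C]

/-! ### Resonances and the number of constants per entry -/

/-- If the first nonzero member of each family of linear maps lies in a prescribed subspace, then
the dimension of the source is at most the sum of the dimensions of these subspaces. -/
theorem finrank_le_sum_of_filtration {ι V F : Type*} [Fintype ι] [AddCommGroup V] [Module ℂ V]
    [AddCommGroup F] [Module ℂ F] [FiniteDimensional ℂ F]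
    (D : ℕ → ι → V →ₗ[ℂ] F) (K : ℕ → ι → Submodule ℂ F)
    (hD : ∀ k w, (∀ j < k, ∀ i, D j i w = 0) → ∀ i, D k i w ∈ K k i)
    (hinj : ∀ w, (∀ k i, D k i w = 0) → w = 0)
    (S : ι → Finset ℕ) (hS : ∀ i, ∀ k ∉ S i, K k i = ⊥) :
    Module.finrank ℂ V ≤ ∑ i, ∑ k ∈ S i, Module.finrank ℂ (K k i) := by
  have hproj : ∀ k i, ∃ π : F →ₗ[ℂ] K k i, π ∘ₗ (K k i).subtype = LinearMap.id := fun k i =>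
    LinearMap.exists_leftInverse_of_injective _ (Submodule.ker_subtype _)
  choose π hπ using hproj
  -- Membership in `K k i` is known only once the earlier maps vanish, so linear projections replace
  -- the values `D k i w`; on the kernel of `Φ` an induction on `k` shows that nothing is lost.
  let Φ : V →ₗ[ℂ] ∀ i, ∀ k : S i, K k i :=
    LinearMap.pi fun i => LinearMap.pi fun k => π k i ∘ₗ D k i
  have hΦ : Function.Injective Φ := by
    rw [← LinearMap.ker_eq_bot, LinearMap.ker_eq_bot']
    intro w hw
    refine hinj w fun k => ?_
    induction k using Nat.strong_induction_on with
    | _ k ih =>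
      intro i
      have hmem := hD k w ih i
      by_cases hk : k ∈ S i
      · have h1 : π k i (D k i w) = 0 := congrFun (congrFun hw i) ⟨k, hk⟩
        have h2 := LinearMap.congr_fun (hπ k i) ⟨_, hmem⟩
        rw [LinearMap.comp_apply, Submodule.subtype_apply, h1] at h2
        exact congrArg Subtype.val h2.symm
      · rwa [hS i k hk, Submodule.mem_bot] at hmem
  refine (LinearMap.finrank_le_finrank_of_injective hΦ).trans_eq ?_
  rw [Module.finrank_pi_fintype]
  refine Finset.sum_congr rfl fun i _ => ?_
  rw [Module.finrank_pi_fintype]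
  exact Finset.sum_coe_sort (S i) fun k => Module.finrank ℂ (K k i)

/-- The possible values in the block `(i, j)` of the first nonzero derivative of the coefficients,
if it is the derivative of the coefficient of `t ^ (k - 1)`. -/
def resonant (α β : ℂ) (k : ℕ) (i j : Fin 4) : Submodule ℂ (Fin 2 → ℂ) where
  carrier := {Z | blockL α β i j *ᵥ Z = ((k : ℂ) - 1) • Z ∧
    (k = 0 → (pVal i - pVal j) * Z 1 = (qVal i - qVal j) * Z 0)}
  add_mem' := by
    rintro Z Z' ⟨h, h0⟩ ⟨h', h0'⟩
    refine ⟨by rw [mulVec_add, h, h', smul_add], fun hk => ?_⟩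
    rw [Pi.add_apply, Pi.add_apply, mul_add, mul_add, h0 hk, h0' hk]
  zero_mem' := ⟨by rw [mulVec_zero, smul_zero], fun _ => by simp⟩
  smul_mem' := by
    rintro r Z ⟨h, h0⟩
    refine ⟨by rw [mulVec_smul, h, smul_comm], fun hk => ?_⟩
    rw [Pi.smul_apply, Pi.smul_apply, smul_eq_mul, smul_eq_mul, mul_left_comm, h0 hk,
      mul_left_comm]

theorem mem_resonant {α β : ℂ} {k : ℕ} {i j : Fin 4} {Z : Fin 2 → ℂ} :
    Z ∈ resonant α β k i j ↔ blockL α β i j *ᵥ Z = ((k : ℂ) - 1) • Z ∧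
      (k = 0 → (pVal i - pVal j) * Z 1 = (qVal i - qVal j) * Z 0) := Iff.rfl

/-- Cayley–Hamilton for the block: multiplying the eigenvector equation by the adjugate of the block
minus `k - 1` shows that `(k - 1 - eig₁)(k - 1 - eig₂)` kills `Z`. -/
theorem resonant_eq_bot {α β : ℂ} {k : ℕ} {i j : Fin 4} (h₁ : (k : ℂ) - 1 ≠ eig₁ i j)
    (h₂ : (k : ℂ) - 1 ≠ eig₂ α β i j) : resonant α β k i j = ⊥ := by
  rw [eq_bot_iff]
  rintro Z ⟨hZ, -⟩
  have ht := blockL_trace α β i j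
  have hd := blockL_det α β i j
  rw [trace_fin_two] at ht
  rw [det_fin_two] at hd
  have e0 := congrFun hZ 0
  have e1 := congrFun hZ 1
  simp only [mulVec, dotProduct, Fin.sum_univ_two, Pi.smul_apply, smul_eq_mul] at e0 e1
  have hne : ((k : ℂ) - 1 - eig₁ i j) * ((k : ℂ) - 1 - eig₂ α β i j) ≠ 0 :=
    mul_ne_zero (sub_ne_zero.2 h₁) (sub_ne_zero.2 h₂)
  rw [Submodule.mem_bot]
  funext l
  refine (mul_eq_zero.1 (?_ : ((k : ℂ) - 1 - eig₁ i j) * ((k : ℂ) - 1 - eig₂ α β i j) * Z l = 0)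
    ).resolve_left hne
  fin_cases l
  · simp only [Fin.zero_eta]
    linear_combination ((blockL α β i j 1 1) - ((k : ℂ) - 1)) * e0 - (blockL α β i j 0 1) * e1
      + ((k : ℂ) - 1) * Z 0 * ht - Z 0 * hd
  · simp only [Fin.mk_one]
    linear_combination ((blockL α β i j 0 0) - ((k : ℂ) - 1)) * e1 - (blockL α β i j 1 0) * e0
      + ((k : ℂ) - 1) * Z 1 * ht - Z 1 * hd

/-- The block is then the scalar `k - 1`. This rules out a two-dimensional resonance when the two
eigenvalues differ. -/
theorem trace_eq_of_resonant_eq_top {α β : ℂ} {k : ℕ} {i j : Fin 4}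
    (h : resonant α β k i j = ⊤) : 2 * ((k : ℂ) - 1) = eig₁ i j + eig₂ α β i j := by
  have h0 := (mem_resonant.1 (h ▸ Submodule.mem_top : ![1, 0] ∈ resonant α β k i j)).1
  have h1 := (mem_resonant.1 (h ▸ Submodule.mem_top : ![0, 1] ∈ resonant α β k i j)).1
  have e0 := congrFun h0 0
  have e1 := congrFun h1 1
  simp [mulVec, dotProduct, Fin.sum_univ_two] at e0 e1
  rw [← blockL_trace, trace_fin_two, e0, e1]
  ring

theorem finrank_resonant_le_two {α β : ℂ} {k : ℕ} {i j : Fin 4} :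
    Module.finrank ℂ (resonant α β k i j) ≤ 2 := by
  simpa using Submodule.finrank_le (resonant α β k i j)

theorem finrank_resonant_le_one {α β : ℂ} {k : ℕ} {i j : Fin 4} (h : resonant α β k i j ≠ ⊤) :
    Module.finrank ℂ (resonant α β k i j) ≤ 1 := by
  have := Submodule.finrank_lt h
  rw [Module.finrank_fin_fun] at this
  omega

open Classical in
/-- The number of arbitrary constants that an entry in the block `(i, j)` can contribute. -/
noncomputable def maxConstants (α β : ℂ) (i j : Fin 4) : ℕ :=
  if i = j then if i = 3 then 2 else 1 else 1 + if ∃ m : ℕ, eig₂ α β i j = m then 1 else 0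

theorem exists_resonant_bound (α β : ℂ) (i j : Fin 4) :
    ∃ S : Finset ℕ, (∀ k ∉ S, resonant α β k i j = ⊥) ∧
      ∑ k ∈ S, Module.finrank ℂ (resonant α β k i j) ≤ maxConstants α β i j := by
  by_cases hij : i = j
  · subst hij
    by_cases hi : i = 3
    · subst hi
      refine ⟨{1}, fun k hk => ?_, ?_⟩
      · have hk' : (k : ℂ) - 1 ≠ 0 := by
          rw [sub_ne_zero]
          exact_mod_cast Finset.notMem_singleton.1 hk
        exact resonant_eq_bot (by simpa [eig₁] using hk') (by simpa [eig₂_three] using hk')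
      · simpa [maxConstants] using finrank_resonant_le_two
    · refine ⟨{3}, fun k hk => ?_, ?_⟩
      · refine resonant_eq_bot ?_ ?_
        · rw [eig₁, if_pos rfl, if_neg hi]
          intro h
          have : ((k + 1 : ℕ) : ℂ) = 0 := by push_cast; linear_combination h
          exact absurd this (Nat.cast_ne_zero.2 k.succ_ne_zero)
        · rw [eig₂_self hi]
          intro h
          have : (k : ℂ) = (3 : ℕ) := by push_cast; linear_combination h
          exact hk (Finset.mem_singleton.2 (Nat.cast_injective this))
      · rw [Finset.sum_singleton, maxConstants, if_pos rfl, if_neg hi]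
        refine finrank_resonant_le_one fun h => ?_
        have := trace_eq_of_resonant_eq_top h
        rw [eig₁, if_pos rfl, if_neg hi, eig₂_self hi] at this
        norm_num at this
  · have he : eig₁ i j = -1 := if_neg hij
    -- Even if `eig₂ = -1` too, only one constant arises: distinct blocks have distinct pairs of
    -- eigenvalues, so the linearized commutation relation is a nontrivial equation.
    have h0 : Module.finrank ℂ (resonant α β 0 i j) ≤ 1 := by
      refine finrank_resonant_le_one fun h => hij ?_
      have h0 := (mem_resonant.1 (h ▸ Submodule.mem_top : ![1, 0] ∈ resonant α β 0 i j)).2 rfl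
      have h1 := (mem_resonant.1 (h ▸ Submodule.mem_top : ![0, 1] ∈ resonant α β 0 i j)).2 rfl
      fin_cases i <;> fin_cases j <;>
        first | rfl | (norm_num [pVal, qVal] at h0; done) | norm_num [pVal, qVal] at h1
    have hne : ∀ k : ℕ, k ≠ 0 → (k : ℂ) - 1 ≠ eig₁ i j := by
      intro k hk h
      rw [he] at h
      exact hk (Nat.cast_eq_zero.1 (by linear_combination h : (k : ℂ) = 0))
    by_cases hm : ∃ m : ℕ, eig₂ α β i j = m
    · rw [maxConstants, if_neg hij, if_pos hm]
      obtain ⟨m, hm⟩ := hm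
      refine ⟨{0, m + 1}, fun k hk => ?_, ?_⟩
      · rw [Finset.mem_insert, Finset.mem_singleton, not_or] at hk
        refine resonant_eq_bot (hne k hk.1) fun h => hk.2 ?_
        rw [hm] at h
        exact Nat.cast_injective (R := ℂ) (by push_cast; linear_combination h)
      · rw [Finset.sum_pair (Nat.succ_ne_zero m).symm]
        refine add_le_add h0 (finrank_resonant_le_one fun h => ?_)
        have := trace_eq_of_resonant_eq_top h
        rw [he, hm] at this
        have h' : ((m + 1 : ℕ) : ℂ) = 0 := by push_cast at this ⊢; linear_combination this
        exact absurd h' (Nat.cast_ne_zero.2 m.succ_ne_zero)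
    · rw [maxConstants, if_neg hij, if_neg hm]
      refine ⟨{0}, fun k hk => ?_, by rwa [Finset.sum_singleton]⟩
      rw [Finset.mem_singleton] at hk
      refine resonant_eq_bot (hne k hk) fun h => hm ⟨k - 1, ?_⟩
      rw [← h, Nat.cast_sub (Nat.one_le_iff_ne_zero.2 hk), Nat.cast_one]

/-! ### Linearization along a family of solutions -/

/-- Entrywise differentiability at `0` of a curve of matrices, with derivative `A'`. -/
def HasEntryDeriv (A : ℂ → Matrix (Fin n) (Fin n) ℂ) (A' : Matrix (Fin n) (Fin n) ℂ) : Prop :=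
  ∀ i j, HasDerivAt (fun t => A t i j) (A' i j) 0

namespace HasEntryDeriv

variable {A B X Y X₁ Y₁ : ℂ → Matrix (Fin n) (Fin n) ℂ}
  {A' B' X' Y' X₁' Y₁' : Matrix (Fin n) (Fin n) ℂ}

theorem unique (h : HasEntryDeriv A A') (h' : HasEntryDeriv A B') : A' = B' :=
  Matrix.ext fun i j => (h i j).unique (h' i j)

theorem congr (h : HasEntryDeriv A A') (hAB : ∀ᶠ t in nhds (0 : ℂ), B t = A t) :
    HasEntryDeriv B A' := fun i j =>
  (h i j).congr_of_eventuallyEq (hAB.mono fun _ ht => congrFun (congrFun ht i) j)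

theorem add (h : HasEntryDeriv A A') (h' : HasEntryDeriv B B') :
    HasEntryDeriv (fun t => A t + B t) (A' + B') := fun i j => (h i j).add (h' i j)

theorem sub (h : HasEntryDeriv A A') (h' : HasEntryDeriv B B') :
    HasEntryDeriv (fun t => A t - B t) (A' - B') := fun i j => (h i j).sub (h' i j)

theorem neg (h : HasEntryDeriv A A') : HasEntryDeriv (fun t => -A t) (-A') :=
  fun i j => (h i j).neg

theorem const_smul (r : ℂ) (h : HasEntryDeriv A A') : HasEntryDeriv (fun t => r • A t) (r • A') :=
  fun i j => (h i j).const_smul r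

theorem mul (h : HasEntryDeriv A A') (h' : HasEntryDeriv B B') :
    HasEntryDeriv (fun t => A t * B t) (A' * B 0 + A 0 * B') := by
  intro i j
  simp only [mul_apply, Matrix.add_apply, ← Finset.sum_add_distrib]
  exact HasDerivAt.fun_sum fun k _ => (h i k).mul (h' k j)

theorem sum {ι : Type*} {s : Finset ι} {A : ι → ℂ → Matrix (Fin n) (Fin n) ℂ}
    {A' : ι → Matrix (Fin n) (Fin n) ℂ} (h : ∀ l ∈ s, HasEntryDeriv (A l) (A' l)) :
    HasEntryDeriv (fun t => ∑ l ∈ s, A l t) (∑ l ∈ s, A' l) := by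
  intro i j
  simp only [Matrix.sum_apply]
  exact HasDerivAt.fun_sum fun l hl => h l hl i j

theorem quad (α : ℂ) (hX : HasEntryDeriv X X') (hY : HasEntryDeriv Y Y')
    (hX₁ : HasEntryDeriv X₁ X₁') (hY₁ : HasEntryDeriv Y₁ Y₁') :
    HasEntryDeriv (fun t => quad α (X t) (Y t) (X₁ t) (Y₁ t))
      (MatrixP4.quad α X' Y' (X₁ 0) (Y₁ 0) + MatrixP4.quad α (X 0) (Y 0) X₁' Y₁') := by
  have h : MatrixP4.quad α X' Y' (X₁ 0) (Y₁ 0) + MatrixP4.quad α (X 0) (Y 0) X₁' Y₁' =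
      -(X' * X₁ 0 + X 0 * X₁') + (2 : ℂ) • (X' * Y₁ 0 + X 0 * Y₁') +
        α • ((X' * Y₁ 0 + X 0 * Y₁') - (Y' * X₁ 0 + Y 0 * X₁')) := by
    unfold MatrixP4.quad
    module
  rw [h]
  exact (((hX.mul hX₁).neg).add ((hX.mul hY₁).const_smul 2)).add
    (((hX.mul hY₁).sub (hY.mul hX₁)).const_smul α)

end HasEntryDeriv

theorem quad_zero_left (α : ℂ) (X Y : Matrix (Fin n) (Fin n) ℂ) : quad α 0 0 X Y = 0 := by
  simp [quad]

theorem quad_zero_right (α : ℂ) (X Y : Matrix (Fin n) (Fin n) ℂ) : quad α X Y 0 0 = 0 := by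
  simp [quad]

theorem opL_apply_eq_quad (α β : ℂ) (p q X Y : Matrix (Fin n) (Fin n) ℂ) :
    opL α β p q (X, Y) =
      (quad α X Y p q + quad α p q X Y, quad β Y X q p + quad β q p Y X) := by
  ext1 <;> simp only [opL, quad, LinearMap.coe_mk, AddHom.coe_mk] <;> module

/-- Derivative of the recurrence relation along a curve of solutions, if the derivatives of the
previous coefficients vanish. -/
theorem deriv_recurrence {α : ℂ} {a b : ℕ → ℂ → Matrix (Fin n) (Fin n) ℂ}
    {a' b' : ℕ → Matrix (Fin n) (Fin n) ℂ} {k : ℕ} (ha : ∀ l, HasEntryDeriv (a l) (a' l))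
    (hb : ∀ l, HasEntryDeriv (b l) (b' l))
    (hrec : ∀ᶠ t in nhds (0 : ℂ), ((k : ℂ) - 1) • a k t =
      ∑ ij ∈ Finset.HasAntidiagonal.antidiagonal k,
        quad α (a ij.1 t) (b ij.1 t) (a ij.2 t) (b ij.2 t))
    (ha0 : ∀ l < k, a' l = 0) (hb0 : ∀ l < k, b' l = 0) :
    ((k : ℂ) - 1) • a' k =
      quad α (a' k) (b' k) (a 0 0) (b 0 0) + quad α (a 0 0) (b 0 0) (a' k) (b' k) := by
  have h1 := (HasEntryDeriv.sum (s := Finset.HasAntidiagonal.antidiagonal k) fun ij _ =>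
    HasEntryDeriv.quad α (ha ij.1) (hb ij.1) (ha ij.2) (hb ij.2)).congr hrec
  rw [((ha k).const_smul _).unique h1, Finset.sum_add_distrib]
  congr 1
  · refine (Finset.sum_eq_single (k, 0) (fun ij hij hne => ?_) fun h => ?_)
    · rw [Finset.HasAntidiagonal.mem_antidiagonal] at hij
      have : ij.1 < k := by
        rcases Nat.lt_or_ge ij.1 k with h | h
        · exact h
        · exact absurd (Prod.ext (by dsimp only; omega) (by dsimp only; omega)) hne
      rw [ha0 _ this, hb0 _ this, quad_zero_left]
    · simp at h
  · refine (Finset.sum_eq_single (0, k) (fun ij hij hne => ?_) fun h => ?_)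
    · rw [Finset.HasAntidiagonal.mem_antidiagonal] at hij
      have : ij.2 < k := by
        rcases Nat.lt_or_ge ij.2 k with h | h
        · exact h
        · exact absurd (Prod.ext (by dsimp only; omega) (by dsimp only; omega)) hne
      rw [ha0 _ this, hb0 _ this, quad_zero_right]
    · simp at h

/-- The entrywise derivative of a matrix-valued function. -/
noncomputable def entryFDeriv {N : ℕ} (A : (Fin N → ℂ) → Matrix (Fin n) (Fin n) ℂ) (c : Fin N → ℂ) :
    (Fin N → ℂ) →ₗ[ℂ] Matrix (Fin n) (Fin n) ℂ where
  toFun w := of fun i j => fderiv ℂ (fun c => A c i j) c w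
  map_add' w w' := by ext i j; simp
  map_smul' r w := by ext i j; simp

theorem hasEntryDeriv_entryFDeriv {N : ℕ} {A : (Fin N → ℂ) → Matrix (Fin n) (Fin n) ℂ}
    {c : Fin N → ℂ} (hA : ∀ i j, DifferentiableAt ℂ (fun c => A c i j) c) (w : Fin N → ℂ) :
    HasEntryDeriv (fun t => A (c + t • w)) (entryFDeriv A c w) := fun i j =>
  (hA i j).hasFDerivAt.hasLineDerivAt w

theorem SameOrbit.commute {p q p' q' : Matrix (Fin n) (Fin n) ℂ} (h : SameOrbit p q p' q')
    (hcomm : p * q = q * p) : p' * q' = q' * p' := by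
  obtain ⟨φ, rfl, rfl⟩ := h.exists_algEquiv
  rw [← map_mul, hcomm, map_mul]

/-- For commuting residues the `α` and `β` terms drop out of the coefficients of `t⁻²`. -/
theorem residue_eq {α β : ℂ} {u v : LaurentSeries (Matrix (Fin n) (Fin n) ℂ)}
    (hu : HasSimplePolarPart u) (hv : HasSimplePolarPart v) (h : IsFormalSolution α β u v)
    (hcomm : residue u * residue v = residue v * residue u) :
    residue u * residue u = residue u + (2 : ℂ) • (residue u * residue v) ∧
      residue v * residue v = residue v + (2 : ℂ) • (residue u * residue v) := by
  have h1 := (equation_iff hu hv).1 h.1 0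
  have h2 := (equation_iff hv hu).1 h.2 0
  simp only [Finset.Nat.antidiagonal_zero, Finset.sum_singleton, quad, Nat.cast_zero, zero_sub,
    neg_smul, one_smul] at h1 h2
  unfold residue at *
  rw [← hcomm, sub_self, smul_zero, add_zero] at h1 h2
  constructor
  · linear_combination (norm := module) h1
  · linear_combination (norm := module) h2

namespace FormalSolutionFamily

variable {α β : ℂ} {p q : Matrix (Fin n) (Fin n) ℂ} {N : ℕ}

theorem exists_hasCanonicalForm (F : FormalSolutionFamily α β p q N) (hcomm : p * q = q * p) :
    ∃ k₁ k₂ k₃ k₄ : ℕ, HasCanonicalForm p q k₁ k₂ k₃ k₄ := by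
  obtain ⟨c, hc⟩ := F.nonempty_U
  obtain ⟨hp, hq⟩ := residue_eq (F.polar_u c hc) (F.polar_v c hc) (F.solution c hc)
    ((F.orbit c hc).commute hcomm)
  obtain ⟨φ, hφp, hφq⟩ := (F.orbit c hc).exists_algEquiv
  rw [← hφp, ← hφq] at hp hq
  refine MatrixP4.exists_hasCanonicalForm hcomm (φ.injective ?_) (φ.injective ?_)
  · simpa using hp
  · simpa using hq

variable (F : FormalSolutionFamily α β p q N) {c : Fin N → ℂ}

/-- The derivative of the coefficient of `t ^ (k - 1)` in `u`. -/
noncomputable def du (c : Fin N → ℂ) (k : ℕ) : (Fin N → ℂ) →ₗ[ℂ] Matrix (Fin n) (Fin n) ℂ :=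
  entryFDeriv (fun c => (F.u c).coeff ((k : ℤ) - 1)) c

/-- The derivative of the coefficient of `t ^ (k - 1)` in `v`. -/
noncomputable def dv (c : Fin N → ℂ) (k : ℕ) : (Fin N → ℂ) →ₗ[ℂ] Matrix (Fin n) (Fin n) ℂ :=
  entryFDeriv (fun c => (F.v c).coeff ((k : ℤ) - 1)) c

theorem hasEntryDeriv_u (hc : c ∈ F.U) (w : Fin N → ℂ) (k : ℕ) :
    HasEntryDeriv (fun t => (F.u (c + t • w)).coeff ((k : ℤ) - 1)) (F.du c k w) :=
  hasEntryDeriv_entryFDeriv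
    (fun i j => (F.holo_u _ i j).differentiableAt (F.isOpen_U.mem_nhds hc)) w

theorem hasEntryDeriv_v (hc : c ∈ F.U) (w : Fin N → ℂ) (k : ℕ) :
    HasEntryDeriv (fun t => (F.v (c + t • w)).coeff ((k : ℤ) - 1)) (F.dv c k w) :=
  hasEntryDeriv_entryFDeriv
    (fun i j => (F.holo_v _ i j).differentiableAt (F.isOpen_U.mem_nhds hc)) w

theorem eventually_mem (hc : c ∈ F.U) (w : Fin N → ℂ) :
    ∀ᶠ t in nhds (0 : ℂ), c + t • w ∈ F.U := by
  have hcont : Continuous fun t : ℂ => c + t • w := by fun_prop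
  refine hcont.continuousAt.eventually_mem (F.isOpen_U.mem_nhds ?_)
  simpa using hc

/-- Among the products in the recurrence only those pairing the `k`-th coefficient with the residue
survive, and together they form `𝓛`. -/
theorem opL_derivative (hc : c ∈ F.U) (w : Fin N → ℂ) (k : ℕ)
    (hu0 : ∀ l < k, F.du c l w = 0) (hv0 : ∀ l < k, F.dv c l w = 0) :
    opL α β (residue (F.u c)) (residue (F.v c)) (F.du c k w, F.dv c k w) =
      ((k : ℂ) - 1) • (F.du c k w, F.dv c k w) := by
  have h1 := deriv_recurrence (α := α) (F.hasEntryDeriv_u hc w) (F.hasEntryDeriv_v hc w)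
    ((F.eventually_mem hc w).mono fun t ht =>
      (equation_iff (F.polar_u _ ht) (F.polar_v _ ht)).1 (F.solution _ ht).1 k) hu0 hv0
  have h2 := deriv_recurrence (α := β) (F.hasEntryDeriv_v hc w) (F.hasEntryDeriv_u hc w)
    ((F.eventually_mem hc w).mono fun t ht =>
      (equation_iff (F.polar_v _ ht) (F.polar_u _ ht)).1 (F.solution _ ht).2 k) hv0 hu0
  simp only [zero_smul, add_zero, Nat.cast_zero, zero_sub] at h1 h2
  rw [opL_apply_eq_quad, Prod.smul_mk, h1, h2]
  rfl

theorem commutator_derivative (hcomm : p * q = q * p) (hc : c ∈ F.U) (w : Fin N → ℂ) :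
    F.du c 0 w * residue (F.v c) + residue (F.u c) * F.dv c 0 w =
      F.dv c 0 w * residue (F.u c) + residue (F.v c) * F.du c 0 w := by
  have hu := F.hasEntryDeriv_u hc w 0
  have hv := F.hasEntryDeriv_v hc w 0
  have := (hu.mul hv).unique ((hv.mul hu).congr ((F.eventually_mem hc w).mono fun t ht => ?_))
  · simpa [residue] using this
  · exact (F.orbit _ ht).commute hcomm

theorem eq_zero_of_derivatives (hc : c ∈ F.U) {w : Fin N → ℂ} (hz : fderiv ℂ F.z₀ c w = 0)
    (hu : ∀ k, F.du c k w = 0) (hv : ∀ k, F.dv c k w = 0) : w = 0 := by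
  have key : ∀ {f : (Fin N → ℂ) → LaurentSeries (Matrix (Fin n) (Fin n) ℂ)},
      (∀ c ∈ F.U, HasSimplePolarPart (f c)) →
      (∀ k : ℕ, entryFDeriv (fun c => (f c).coeff ((k : ℤ) - 1)) c w = 0) →
      ∀ (m : ℤ) (i j : Fin n), fderiv ℂ (fun c => (f c).coeff m i j) c w = 0 := by
    intro f hf h m i j
    rcases lt_or_ge m (-1) with hm | hm
    · have : (fun c => (f c).coeff m i j) =ᶠ[nhds c] fun _ => 0 := by
        filter_upwards [F.isOpen_U.mem_nhds hc] with c hc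
        rw [hf c hc m hm, Matrix.zero_apply]
      rw [this.fderiv_eq]
      simp
    · obtain ⟨k, rfl⟩ : ∃ k : ℕ, m = (k : ℤ) - 1 := ⟨(m + 1).toNat, by omega⟩
      exact congrFun (congrFun (h k) i) j
  exact F.independent c hc w hz (key F.polar_u hu) (key F.polar_v hv)

end FormalSolutionFamily

/-! ### Upper bound for the number of constants -/

/-- The number of arbitrary constants in a solution whose residues commute. -/
theorem FormalSolutionFamily.card_le {α β : ℂ} {p q : Matrix (Fin n) (Fin n) ℂ} {N : ℕ}
    (F : FormalSolutionFamily α β p q N) {τ : Fin n → Fin 4}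
    (h : SameOrbit (diagonal fun a => pVal (τ a)) (diagonal fun a => qVal (τ a)) p q) :
    N ≤ 1 + ∑ x : Fin n × Fin n, maxConstants α β (τ x.1) (τ x.2) := by
  have hcomm : p * q = q * p := h.commute (by
    rw [diagonal_mul_diagonal, diagonal_mul_diagonal]
    simp only [mul_comm])
  obtain ⟨c, hc⟩ := F.nonempty_U
  obtain ⟨φ₁, hφ₁p, hφ₁q⟩ := h.exists_algEquiv
  obtain ⟨φ₂, hφ₂p, hφ₂q⟩ := (F.orbit c hc).exists_algEquiv
  let φ := φ₁.trans φ₂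
  have hφp : residue (F.u c) = φ (diagonal fun a => pVal (τ a)) := by
    rw [← hφ₂p, ← hφ₁p]; rfl
  have hφq : residue (F.v c) = φ (diagonal fun a => qVal (τ a)) := by
    rw [← hφ₂q, ← hφ₁q]; rfl
  let V : Submodule ℂ (Fin N → ℂ) := LinearMap.ker (fderiv ℂ F.z₀ c).toLinearMap
  -- The differential of `z₀` has rank at most one; the remaining constants are counted on its
  -- kernel.
  have hV : N ≤ 1 + Module.finrank ℂ V := by
    have h1 := LinearMap.finrank_range_add_finrank_ker (fderiv ℂ F.z₀ c).toLinearMap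
    have h2 := Submodule.finrank_le (LinearMap.range (fderiv ℂ F.z₀ c).toLinearMap)
    rw [Module.finrank_fin_fun] at h1
    rw [Module.finrank_self] at h2
    change _ + Module.finrank ℂ V = N at h1
    omega
  choose S hS hSle using fun x : Fin n × Fin n => exists_resonant_bound α β (τ x.1) (τ x.2)
  refine hV.trans (Nat.add_le_add_left ?_ 1)
  refine le_trans ?_ (Finset.sum_le_sum fun x _ => hSle x)
  -- The derivatives are conjugated back to the frame in which both residues at `c` are diagonal.
  let X : ℕ → V →ₗ[ℂ] Matrix (Fin n) (Fin n) ℂ := fun k =>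
    φ.symm.toLinearMap ∘ₗ F.du c k ∘ₗ V.subtype
  let Y : ℕ → V →ₗ[ℂ] Matrix (Fin n) (Fin n) ℂ := fun k =>
    φ.symm.toLinearMap ∘ₗ F.dv c k ∘ₗ V.subtype
  have hX : ∀ k w, φ (X k w) = F.du c k w := fun k w => φ.apply_symm_apply _
  have hY : ∀ k w, φ (Y k w) = F.dv c k w := fun k w => φ.apply_symm_apply _
  let D : ℕ → Fin n × Fin n → V →ₗ[ℂ] (Fin 2 → ℂ) := fun k x =>
    { toFun := fun w => ![X k w x.1 x.2, Y k w x.1 x.2]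
      map_add' := fun w w' => by simp
      map_smul' := fun r w => by simp }
  have hDzero : ∀ k (w : V), (∀ x, D k x w = 0) → F.du c k w = 0 ∧ F.dv c k w = 0 := by
    intro k w hw
    rw [← hX, ← hY]
    constructor
    · rw [show X k w = 0 from Matrix.ext fun i j => congrFun (hw (i, j)) 0, map_zero]
    · rw [show Y k w = 0 from Matrix.ext fun i j => congrFun (hw (i, j)) 1, map_zero]
  refine finrank_le_sum_of_filtration D (fun k x => resonant α β k (τ x.1) (τ x.2)) ?_ ?_ S hS
  · rintro k w hlow ⟨a, b⟩
    have hL := F.opL_derivative hc w k (fun l hl => (hDzero l w (hlow l hl)).1)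
      fun l hl => (hDzero l w (hlow l hl)).2
    rw [← hX, ← hY, hφp, hφq, opL_map] at hL
    rw [mem_resonant]
    constructor
    · refine (opL_diagonal_entry α β τ (X k w, Y k w) a b).symm.trans ?_
      have e1 : (opL α β (diagonal fun a => pVal (τ a)) (diagonal fun a => qVal (τ a))
          (X k w, Y k w)).1 = ((k : ℂ) - 1) • X k w :=
        φ.injective ((congrArg Prod.fst hL).trans (map_smul φ _ _).symm)
      have e2 : (opL α β (diagonal fun a => pVal (τ a)) (diagonal fun a => qVal (τ a))
          (X k w, Y k w)).2 = ((k : ℂ) - 1) • Y k w :=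
        φ.injective ((congrArg Prod.snd hL).trans (map_smul φ _ _).symm)
      rw [e1, e2]
      funext i
      fin_cases i <;> rfl
    · rintro rfl
      have hC := F.commutator_derivative hcomm hc w
      rw [← hX, ← hY, hφp, hφq, ← map_mul, ← map_mul, ← map_mul, ← map_mul, ← map_add,
        ← map_add] at hC
      have e := congrFun (congrFun (φ.injective hC) a) b
      simp only [Matrix.add_apply, diagonal_mul, mul_diagonal] at e
      change (pVal (τ a) - pVal (τ b)) * Y 0 w a b = (qVal (τ a) - qVal (τ b)) * X 0 w a b
      linear_combination e
  · intro w hw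
    exact Subtype.ext (F.eq_zero_of_derivatives hc w.2 (fun k => (hDzero k w (hw k)).1)
      fun k => (hDzero k w (hw k)).2)

/-! ### Solutions without pole -/

/-- The coefficients, shifted by one, of the formal solution without pole with the given constant
terms. -/
noncomputable def regularCoeff (α β : ℂ) (x y : Matrix (Fin n) (Fin n) ℂ) :
    ℕ → Matrix (Fin n) (Fin n) ℂ × Matrix (Fin n) (Fin n) ℂ
  | 0 => 0
  | 1 => (x, y)
  | k + 2 => ((k : ℂ) + 1)⁻¹ • ∑ i : Fin (k + 1),
      (quad α (regularCoeff α β x y (i + 1)).1 (regularCoeff α β x y (i + 1)).2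
          (regularCoeff α β x y (k + 1 - i)).1 (regularCoeff α β x y (k + 1 - i)).2,
        quad β (regularCoeff α β x y (i + 1)).2 (regularCoeff α β x y (i + 1)).1
          (regularCoeff α β x y (k + 1 - i)).2 (regularCoeff α β x y (k + 1 - i)).1)
  decreasing_by all_goals omega

theorem regularCoeff_zero (α β : ℂ) (x y : Matrix (Fin n) (Fin n) ℂ) :
    regularCoeff α β x y 0 = 0 := by rw [regularCoeff]

theorem regularCoeff_one (α β : ℂ) (x y : Matrix (Fin n) (Fin n) ℂ) :
    regularCoeff α β x y 1 = (x, y) := by rw [regularCoeff]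

/-- The two end terms contain the zero residue, so the coefficient being solved for does not occur
on the right. -/
theorem sum_antidiagonal_quad (α : ℂ) {a b : ℕ → Matrix (Fin n) (Fin n) ℂ} (ha : a 0 = 0)
    (hb : b 0 = 0) (k : ℕ) : ∑ ij ∈ Finset.HasAntidiagonal.antidiagonal (k + 2),
      quad α (a ij.1) (b ij.1) (a ij.2) (b ij.2) =
      ∑ i : Fin (k + 1), quad α (a (i + 1)) (b (i + 1)) (a (k + 1 - i)) (b (k + 1 - i)) := by
  rw [Finset.Nat.sum_antidiagonal_eq_sum_range_succ_mk, Finset.sum_range_succ,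
    Finset.sum_range_succ']
  simp only [Nat.sub_self, ha, hb, quad_zero_left, quad_zero_right, add_zero]
  rw [Finset.sum_range]
  refine Finset.sum_congr rfl fun i _ => ?_
  rw [show k + 2 - ((i : ℕ) + 1) = k + 1 - i by omega]

/-- The factor `k - 1` vanishes only at `k = 1`, where both sides are zero and the constant terms
stay free. -/
theorem regularCoeff_recurrence (α β : ℂ) (x y : Matrix (Fin n) (Fin n) ℂ) (k : ℕ) :
    ((k : ℂ) - 1) • (regularCoeff α β x y k).1 = ∑ ij ∈ Finset.HasAntidiagonal.antidiagonal k,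
        quad α (regularCoeff α β x y ij.1).1 (regularCoeff α β x y ij.1).2
          (regularCoeff α β x y ij.2).1 (regularCoeff α β x y ij.2).2 ∧
      ((k : ℂ) - 1) • (regularCoeff α β x y k).2 = ∑ ij ∈ Finset.HasAntidiagonal.antidiagonal k,
        quad β (regularCoeff α β x y ij.1).2 (regularCoeff α β x y ij.1).1
          (regularCoeff α β x y ij.2).2 (regularCoeff α β x y ij.2).1 := by
  match k with
  | 0 => simp [regularCoeff_zero, quad]
  | 1 => simp [Finset.Nat.antidiagonal_succ, regularCoeff_zero, quad]
  | k + 2 =>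
    have hk : (((k + 2 : ℕ) : ℂ) - 1) * ((k : ℂ) + 1)⁻¹ = 1 := by
      have : (k : ℂ) + 1 ≠ 0 := Nat.cast_add_one_ne_zero k
      push_cast
      field_simp
      ring
    have h0 := regularCoeff_zero α β x y
    rw [sum_antidiagonal_quad α (a := fun k => (regularCoeff α β x y k).1)
        (b := fun k => (regularCoeff α β x y k).2) (by rw [h0]; rfl) (by rw [h0]; rfl),
      sum_antidiagonal_quad β (a := fun k => (regularCoeff α β x y k).2)
        (b := fun k => (regularCoeff α β x y k).1) (by rw [h0]; rfl) (by rw [h0]; rfl),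
      regularCoeff, Prod.smul_fst, Prod.smul_snd, smul_smul, smul_smul, hk, one_smul, one_smul,
      Prod.fst_sum, Prod.snd_sum]
    exact ⟨rfl, rfl⟩

/-- The Laurent series `∑ aₖ t ^ (k - 1)`. -/
def seriesOfCoeff (a : ℕ → Matrix (Fin n) (Fin n) ℂ) :
    LaurentSeries (Matrix (Fin n) (Fin n) ℂ) :=
  HahnSeries.ofSuppBddBelow (fun m : ℤ => if m < -1 then 0 else a (m + 1).toNat) <| by
    refine ⟨-1, fun m hm => ?_⟩
    by_contra h
    exact hm (if_pos (not_le.1 h))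

theorem seriesOfCoeff_coeff_of_lt (a : ℕ → Matrix (Fin n) (Fin n) ℂ) {m : ℤ} (hm : m < -1) :
    (seriesOfCoeff a).coeff m = 0 := if_pos hm

theorem seriesOfCoeff_coeff (a : ℕ → Matrix (Fin n) (Fin n) ℂ) (k : ℕ) :
    (seriesOfCoeff a).coeff ((k : ℤ) - 1) = a k := by
  refine (if_neg (by omega)).trans ?_
  rw [show ((k : ℤ) - 1 + 1).toNat = k by omega]

theorem differentiable_quad {E : Type*} [NormedAddCommGroup E] [NormedSpace ℂ E] (α : ℂ)
    {X Y X' Y' : E → Matrix (Fin n) (Fin n) ℂ}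
    (hX : ∀ i j, Differentiable ℂ fun c => X c i j) (hY : ∀ i j, Differentiable ℂ fun c => Y c i j)
    (hX' : ∀ i j, Differentiable ℂ fun c => X' c i j)
    (hY' : ∀ i j, Differentiable ℂ fun c => Y' c i j) (i j : Fin n) :
    Differentiable ℂ fun c => quad α (X c) (Y c) (X' c) (Y' c) i j := by
  have hmul : ∀ {A B : E → Matrix (Fin n) (Fin n) ℂ},
      (∀ i j, Differentiable ℂ fun c => A c i j) → (∀ i j, Differentiable ℂ fun c => B c i j) →
      Differentiable ℂ fun c => (A c * B c) i j := by
    intro A B hA hB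
    simp only [mul_apply]
    exact Differentiable.fun_sum fun k _ => (hA i k).mul (hB k j)
  exact ((hmul hX hX').neg.add ((hmul hX hY').const_smul (2 : ℂ))).add
    (((hmul hX hY').sub (hmul hY hX')).const_smul α)

theorem differentiable_regularCoeff {E : Type*} [NormedAddCommGroup E] [NormedSpace ℂ E]
    (α β : ℂ) {x y : E → Matrix (Fin n) (Fin n) ℂ}
    (hx : ∀ i j, Differentiable ℂ fun c => x c i j) (hy : ∀ i j, Differentiable ℂ fun c => y c i j)
    (k : ℕ) : (∀ i j, Differentiable ℂ fun c => (regularCoeff α β (x c) (y c) k).1 i j) ∧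
      ∀ i j, Differentiable ℂ fun c => (regularCoeff α β (x c) (y c) k).2 i j := by
  induction k using Nat.strong_induction_on with
  | _ k ih =>
    match k with
    | 0 =>
      simp only [regularCoeff_zero, Prod.fst_zero, Prod.snd_zero, Matrix.zero_apply]
      exact ⟨fun _ _ => differentiable_const _, fun _ _ => differentiable_const _⟩
    | 1 =>
      simp only [regularCoeff_one]
      exact ⟨hx, hy⟩
    | k + 2 =>
      simp only [regularCoeff, Prod.smul_fst, Prod.smul_snd, Prod.fst_sum, Prod.snd_sum,
        Matrix.smul_apply, Matrix.sum_apply]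
      constructor
      · intro i j
        refine Differentiable.fun_const_smul (Differentiable.fun_sum fun l _ => ?_) _
        have h1 := ih (l + 1) (by omega)
        have h2 := ih (k + 1 - l) (by omega)
        exact differentiable_quad α h1.1 h1.2 h2.1 h2.2 i j
      · intro i j
        refine Differentiable.fun_const_smul (Differentiable.fun_sum fun l _ => ?_) _
        have h1 := ih (l + 1) (by omega)
        have h2 := ih (k + 1 - l) (by omega)
        exact differentiable_quad β h1.2 h1.1 h2.2 h2.1 i j

theorem differentiable_seriesOfCoeff {E : Type*} [NormedAddCommGroup E] [NormedSpace ℂ E]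
    {a : E → ℕ → Matrix (Fin n) (Fin n) ℂ} (ha : ∀ k i j, Differentiable ℂ fun c => a c k i j)
    (m : ℤ) (i j : Fin n) : Differentiable ℂ fun c => (seriesOfCoeff (a c)).coeff m i j := by
  rcases lt_or_ge m (-1) with hm | hm
  · simp only [seriesOfCoeff_coeff_of_lt _ hm, Matrix.zero_apply]
    exact differentiable_const _
  · obtain ⟨k, rfl⟩ : ∃ k : ℕ, m = (k : ℤ) - 1 := ⟨(m + 1).toNat, by omega⟩
    simp only [seriesOfCoeff_coeff]
    exact ha k i j

/-- The solutions without pole contain `2n² + 1` arbitrary constants: the point `z₀` and the values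
of `u` and `v` at this point. -/
theorem nonempty_regular_family (α β : ℂ) :
    Nonempty (FormalSolutionFamily α β (0 : Matrix (Fin n) (Fin n) ℂ) 0 (2 * n ^ 2 + 1)) := by
  let E : Unit ⊕ (Fin n × Fin n) ⊕ (Fin n × Fin n) ≃ Fin (2 * n ^ 2 + 1) :=
    Fintype.equivOfCardEq (by simp; ring)
  let x : (Fin (2 * n ^ 2 + 1) → ℂ) → Matrix (Fin n) (Fin n) ℂ :=
    fun c => of fun i j => c (E (.inr (.inl (i, j))))
  let y : (Fin (2 * n ^ 2 + 1) → ℂ) → Matrix (Fin n) (Fin n) ℂ :=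
    fun c => of fun i j => c (E (.inr (.inr (i, j))))
  have hx : ∀ i j, Differentiable ℂ fun c => x c i j := fun i j => differentiable_apply _
  have hy : ∀ i j, Differentiable ℂ fun c => y c i j := fun i j => differentiable_apply _
  let u := fun c => seriesOfCoeff fun k => (regularCoeff α β (x c) (y c) k).1
  let v := fun c => seriesOfCoeff fun k => (regularCoeff α β (x c) (y c) k).2
  have hu : ∀ c, HasSimplePolarPart (u c) := fun c m hm => seriesOfCoeff_coeff_of_lt _ hm
  have hv : ∀ c, HasSimplePolarPart (v c) := fun c m hm => seriesOfCoeff_coeff_of_lt _ hm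
  have hcoord : ∀ (l : Fin (2 * n ^ 2 + 1)) (c w : Fin (2 * n ^ 2 + 1) → ℂ),
      fderiv ℂ (fun c : Fin (2 * n ^ 2 + 1) → ℂ => c l) c w = w l := by
    intro l c w
    rw [(hasFDerivAt_apply l c).fderiv]
    rfl
  refine ⟨{
    U := Set.univ
    isOpen_U := isOpen_univ
    nonempty_U := Set.univ_nonempty
    z₀ := fun c => c (E (.inl ()))
    u := u
    v := v
    polar_u := fun c _ => hu c
    polar_v := fun c _ => hv c
    solution := fun c _ => ⟨(equation_iff (hu c) (hv c)).2 fun k => ?_,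
      (equation_iff (hv c) (hu c)).2 fun k => ?_⟩
    orbit := fun c _ => ⟨1, ?_, ?_⟩
    holo_z₀ := (differentiable_apply _).differentiableOn
    holo_u := fun m i j => (differentiable_seriesOfCoeff
      (fun k => (differentiable_regularCoeff α β hx hy k).1) m i j).differentiableOn
    holo_v := fun m i j => (differentiable_seriesOfCoeff
      (fun k => (differentiable_regularCoeff α β hx hy k).2) m i j).differentiableOn
    independent := ?_ }⟩
  · simp only [u, v, seriesOfCoeff_coeff]
    exact (regularCoeff_recurrence α β (x c) (y c) k).1
  · simp only [u, v, seriesOfCoeff_coeff]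
    exact (regularCoeff_recurrence α β (x c) (y c) k).2
  · have := seriesOfCoeff_coeff (fun k => (regularCoeff α β (x c) (y c) k).1) 0
    rw [regularCoeff_zero] at this
    simpa [residue] using this
  · have := seriesOfCoeff_coeff (fun k => (regularCoeff α β (x c) (y c) k).2) 0
    rw [regularCoeff_zero] at this
    simpa [residue] using this
  · intro c _ w hz hu' hv'
    -- Together with `z₀`, the constant terms recover all coordinates of `c`, whence independence.
    have hcoeff : ∀ c, (u c).coeff 0 = x c ∧ (v c).coeff 0 = y c := by
      intro c
      have h1 := seriesOfCoeff_coeff (fun k => (regularCoeff α β (x c) (y c) k).1) 1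
      have h2 := seriesOfCoeff_coeff (fun k => (regularCoeff α β (x c) (y c) k).2) 1
      rw [regularCoeff_one, Nat.cast_one, sub_self] at h1 h2
      exact ⟨h1, h2⟩
    funext l
    obtain ⟨l, rfl⟩ := E.surjective l
    rcases l with ⟨⟩ | ⟨i, j⟩ | ⟨i, j⟩
    · rw [← hcoord _ c w]
      exact hz
    · have := hu' 0 i j
      simp only [(hcoeff _).1] at this
      rw [← hcoord _ c w]
      exact this
    · have := hv' 0 i j
      simp only [(hcoeff _).2] at this
      rw [← hcoord _ c w]
      exact this

/-! ### Comparison with the maximal number -/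

theorem sum_blockIndex_prod {M : Type*} [AddCommMonoid M] {k₁ k₂ k₃ k₄ : ℕ}
    (e : Fin n ≃ Fin k₁ ⊕ Fin k₂ ⊕ Fin k₃ ⊕ Fin k₄) (f : Fin 4 → Fin 4 → M) :
    ∑ x : Fin n × Fin n, f (blockIndex (e x.1)) (blockIndex (e x.2)) =
      k₁ • (k₁ • f 0 0 + (k₂ • f 0 1 + (k₃ • f 0 2 + k₄ • f 0 3))) +
      (k₂ • (k₁ • f 1 0 + (k₂ • f 1 1 + (k₃ • f 1 2 + k₄ • f 1 3))) +
      (k₃ • (k₁ • f 2 0 + (k₂ • f 2 1 + (k₃ • f 2 2 + k₄ • f 2 3))) +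
      k₄ • (k₁ • f 3 0 + (k₂ • f 3 1 + (k₃ • f 3 2 + k₄ • f 3 3))))) := by
  rw [Fintype.sum_prod_type]
  simp only [sum_blockIndex e]
  exact sum_blockIndex e fun i => k₁ • f i 0 + (k₂ • f i 1 + (k₃ • f i 2 + k₄ • f i 3))

open Classical in
theorem maxConstants_add (α β : ℂ) (i j : Fin 4) :
    maxConstants α β i j + (if i = j ∧ i ≠ 3 then 1 else 0) +
      (if ∃ m : ℕ, eig₂ α β i j = m then 0 else 1) = 2 := by
  by_cases hij : i = j
  · subst hij
    by_cases hi : i = 3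
    · subst hi
      rw [if_pos (show ∃ m : ℕ, eig₂ α β 3 3 = m from ⟨0, by rw [eig₂_three, Nat.cast_zero]⟩)]
      simp [maxConstants]
    · rw [if_pos (show ∃ m : ℕ, eig₂ α β i i = m from ⟨2, by rw [eig₂_self hi, Nat.cast_ofNat]⟩)]
      simp [maxConstants, hi]
  · by_cases hm : ∃ m : ℕ, eig₂ α β i j = m
    · simp only [maxConstants, hij, hm, if_true, if_false, false_and]
    · simp only [maxConstants, hij, hm, if_false, false_and]

/-- For a maximal formal solution there is exactly one eigenvalue `-2`, and all the eigenvalues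
that depend on `α` and `β` are nonnegative integers. -/
theorem IsMaximal.eigenvalues {α β : ℂ} {p q : Matrix (Fin n) (Fin n) ℂ}
    (hmax : IsMaximal α β p q) {k₁ k₂ k₃ k₄ : ℕ}
    (e : Fin n ≃ Fin k₁ ⊕ Fin k₂ ⊕ Fin k₃ ⊕ Fin k₄)
    (h : SameOrbit (diagonal fun a => pVal (blockIndex (e a)))
      (diagonal fun a => qVal (blockIndex (e a))) p q) :
    k₁ ^ 2 + k₂ ^ 2 + k₃ ^ 2 = 1 ∧
      ∀ a b, ∃ m : ℕ, eig₂ α β (blockIndex (e a)) (blockIndex (e b)) = m := by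
  classical
  obtain ⟨⟨F⟩, hub⟩ := hmax
  have hle := F.card_le h
  have hsum : ∑ x : Fin n × Fin n, maxConstants α β (blockIndex (e x.1)) (blockIndex (e x.2)) +
      ∑ x : Fin n × Fin n,
        (if blockIndex (e x.1) = blockIndex (e x.2) ∧ blockIndex (e x.1) ≠ 3 then 1 else 0) +
      ∑ x : Fin n × Fin n,
        (if ∃ m : ℕ, eig₂ α β (blockIndex (e x.1)) (blockIndex (e x.2)) = m then 0 else 1) =
      2 * n ^ 2 := by
    rw [← Finset.sum_add_distrib, ← Finset.sum_add_distrib,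
      Finset.sum_congr rfl fun x _ => maxConstants_add α β _ _]
    simp
    ring
  have hK : ∑ x : Fin n × Fin n,
      (if blockIndex (e x.1) = blockIndex (e x.2) ∧ blockIndex (e x.1) ≠ 3 then 1 else 0) =
      k₁ ^ 2 + k₂ ^ 2 + k₃ ^ 2 := by
    rw [sum_blockIndex_prod e fun i j => if i = j ∧ i ≠ 3 then 1 else 0]
    simp
    ring
  rw [hK] at hsum
  -- Otherwise only the block with eigenvalues `(0, 0)` is left, so both residues vanish and
  -- `nonempty_regular_family` exceeds the supposed maximum.
  have hpos : k₁ ^ 2 + k₂ ^ 2 + k₃ ^ 2 ≠ 0 := by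
    intro h0
    have h₁ : k₁ = 0 := by
      by_contra hk
      have := pow_pos (Nat.pos_of_ne_zero hk) 2
      omega
    have h₂ : k₂ = 0 := by
      by_contra hk
      have := pow_pos (Nat.pos_of_ne_zero hk) 2
      omega
    have h₃ : k₃ = 0 := by
      by_contra hk
      have := pow_pos (Nat.pos_of_ne_zero hk) 2
      omega
    subst h₁ h₂ h₃
    have hb : ∀ a, blockIndex (e a) = 3 := by
      intro a
      rcases e a with x | x | x | x
      exacts [x.elim0, x.elim0, x.elim0, rfl]
    simp only [hb] at h
    obtain ⟨φ, rfl, rfl⟩ := h.exists_algEquiv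
    have hp0 : (diagonal fun _ : Fin n => pVal 3) = 0 := by simp [pVal]
    have hq0 : (diagonal fun _ : Fin n => qVal 3) = 0 := by simp [qVal]
    rw [hp0, hq0, map_zero] at hub
    exact absurd (hub (nonempty_regular_family α β)) (by omega)
  -- The bounds leave a total defect of at most one, and the nonzero sum of squares already uses it
  -- up; a single bad `eig₂` would exceed it.
  refine ⟨by omega, fun a b => ?_⟩
  by_contra hab
  have hbad := Finset.single_le_sum (f := fun x : Fin n × Fin n =>
    if ∃ m : ℕ, eig₂ α β (blockIndex (e x.1)) (blockIndex (e x.2)) = m then 0 else 1)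
    (fun x _ => Nat.zero_le _) (Finset.mem_univ (a, b))
  simp only [hab, if_false] at hbad
  omega

/-- The roots of the characteristic polynomial of `𝓛` for the canonical form. -/
theorem exists_roots_charpoly_opL {α β : ℂ} {p q : Matrix (Fin n) (Fin n) ℂ} {k₁ k₂ k₃ k₄ : ℕ}
    (e : Fin n ≃ Fin k₁ ⊕ Fin k₂ ⊕ Fin k₃ ⊕ Fin k₄)
    (h : SameOrbit (diagonal fun a => pVal (blockIndex (e a)))
      (diagonal fun a => qVal (blockIndex (e a))) p q)
    (hint : ∀ a b, ∃ m : ℕ, eig₂ α β (blockIndex (e a)) (blockIndex (e b)) = m) :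
    ∃ s : Multiset ℕ, (opL α β p q).charpoly.roots =
      Multiset.replicate (k₁ ^ 2 + k₂ ^ 2 + k₃ ^ 2) (-2)
        + Multiset.replicate
            (2 * (k₁ * k₂ + k₁ * k₃ + k₂ * k₃ + k₁ * k₄ + k₂ * k₄ + k₃ * k₄)) (-1)
        + s.map (fun m : ℕ => (m : ℂ)) := by
  choose m hm using hint
  have h₁ : ∑ x : Fin n × Fin n, ({eig₁ (blockIndex (e x.1)) (blockIndex (e x.2))} : Multiset ℂ) =
      (k₁ ^ 2 + k₂ ^ 2 + k₃ ^ 2) • {-2} +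
      (2 * (k₁ * k₂ + k₁ * k₃ + k₂ * k₃ + k₁ * k₄ + k₂ * k₄ + k₃ * k₄)) • {-1} +
      (k₄ ^ 2) • {0} := by
    rw [sum_blockIndex_prod e fun i j => {eig₁ i j}]
    simp only [eig₁, Fin.isValue, Fin.reduceEq, if_true, if_false]
    module
  have h₂ : ∑ x : Fin n × Fin n,
      ({eig₂ α β (blockIndex (e x.1)) (blockIndex (e x.2))} : Multiset ℂ) =
      (∑ x : Fin n × Fin n, ({m x.1 x.2} : Multiset ℕ)).map (fun m : ℕ => (m : ℂ)) := by
    rw [← Multiset.coe_mapAddMonoidHom, map_sum]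
    refine Finset.sum_congr rfl fun x _ => ?_
    rw [Multiset.coe_mapAddMonoidHom, Multiset.map_singleton, hm]
  -- The natural-number eigenvalues are the `k₄²` zeros among the `eig₁` and all of the `eig₂`.
  refine ⟨Multiset.replicate (k₄ ^ 2) 0 + ∑ x : Fin n × Fin n, {m x.1 x.2}, ?_⟩
  rw [roots_charpoly_opL h, Finset.sum_add_distrib, h₁, h₂, Multiset.map_add,
    Multiset.map_replicate, Nat.cast_zero, Multiset.nsmul_singleton, Multiset.nsmul_singleton,
    Multiset.nsmul_singleton, add_assoc]

end MatrixP4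

theorem mainTheorem9 (n : ℕ) (α β : ℂ) (p q : Matrix (Fin n) (Fin n) ℂ)
    (hcomm : p * q = q * p) (hmax : MatrixP4.IsMaximal α β p q) :
    (∃ k₁ k₂ k₃ k₄ : ℕ, MatrixP4.HasCanonicalForm p q k₁ k₂ k₃ k₄) ∧
    ∀ k₁ k₂ k₃ k₄ : ℕ, MatrixP4.HasCanonicalForm p q k₁ k₂ k₃ k₄ →
      k₁ ^ 2 + k₂ ^ 2 + k₃ ^ 2 = 1 ∧
      (∀ μ : ℂ, Module.End.HasEigenvalue (MatrixP4.opL α β p q) μ → μ ≠ -1 → μ ≠ -2 →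
        ∃ m : ℕ, μ = m) ∧
      (∃ s : Multiset ℕ, (MatrixP4.opL α β p q).charpoly.roots =
        Multiset.replicate (k₁ ^ 2 + k₂ ^ 2 + k₃ ^ 2) (-2)
          + Multiset.replicate
              (2 * (k₁ * k₂ + k₁ * k₃ + k₂ * k₃ + k₁ * k₄ + k₂ * k₄ + k₃ * k₄)) (-1)
          + s.map (fun m : ℕ => (m : ℂ))) := by
  obtain ⟨F⟩ := hmax.1
  refine ⟨F.exists_hasCanonicalForm hcomm, ?_⟩
  rintro k₁ k₂ k₃ k₄ ⟨e, he⟩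
  rw [MatrixP4.canonicalP_submatrix, MatrixP4.canonicalQ_submatrix] at he
  obtain ⟨hK, hint⟩ := hmax.eigenvalues e he
  have hroots := MatrixP4.exists_roots_charpoly_opL e he hint
  refine ⟨hK, fun μ hμ h₁ h₂ => ?_, hroots⟩
  obtain ⟨s, hs⟩ := hroots
  rw [Module.End.hasEigenvalue_iff_isRoot_charpoly,
    ← Polynomial.mem_roots (LinearMap.charpoly_monic _).ne_zero, hs, Multiset.mem_add,
    Multiset.mem_add] at hμ
  rcases hμ with (hμ | hμ) | hμ
  · exact absurd (Multiset.eq_of_mem_replicate hμ) h₂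
  · exact absurd (Multiset.eq_of_mem_replicate hμ) h₁
  · obtain ⟨m, -, rfl⟩ := Multiset.mem_map.1 hμ
    exact ⟨m, rfl⟩
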